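/- Let $M$ be a smooth (finite-dimensional, Hausdorff, second countable) manifold without boundary with a symplectic form $\omega$ (a smooth, closed, nondegenerate $2$-form), let $G$ be a (finite-dimensional, second countable) real Lie group with Lie algebra $\mathfrak g$, and let $\Phi : G\times M\to M$ be a smooth symplectic action, i.e. $\Phi_g^*\omega=\omega$ for all $g\in G$. For $\xi\in\mathfrak g$ let $\xi_M$ be the corresponding infinitesimal generator, $\xi_M(x)=\frac{d}{dt}\big|_{t=0}\Phi(\exp(t\xi),x)$. Let $J:M\to\mathfrak g^*$ be an $\mathrm{Ad}^*$-equivariant momentum map: $J$ is smooth, for every $\xi\in\mathfrak g$ the function $\hat J(\xi)(x)=J(x)\xi$ satisfies $d\hat J(\xi)=\omega(\xi_M,\cdot)$, and $J(\Phi_g(x))=\mathrm{Ad}^*_{g^{-1}}J(x)=J(x)\circ \mathrm{Ad}_{g^{-1}}$ for all $g\in G$, $x\in M$. Let $\mu\in\mathfrak g^*$ be a regular value of $J$, and let $G_\mu=\{g\in G \mid \mathrm{Ad}^*_{g^{-1}}\mu=\mu\}$. Write $Gx$ and $G_\mu x$ for the orbits of $x$ under $G$ and $G_\mu$; for a subspace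 $V\subseteq T_xM$ let $V^\perp=\{v\in T_xM \mid \omega(v,w)=0 \text{ for all } w\in V\}$. A submanifold $N\subseteq M$ is coisotropic if $(T_yN)^\perp\subseteq T_yN$ for all $y\in N$. For each of the sets $S = Gx,\ G_\mu x,\ J^{-1}(\mu)$, the tangent space $T_xS\subseteq T_xM$ consists of the velocities at $x$ of the smooth curves of $M$ through $x$ that lie in $S$. Then for every $x\in J^{-1}(\mu)$: (i) $T_x(G_\mu x)=T_x(Gx)\cap T_xJ^{-1}(\mu)$. (ii) $T_xJ^{-1}(\mu)=T_x(Gx)^\perp$. (iii) If $G_\mu=G$, then $T_x(Gx)\subseteq T_xJ^{-1}(\mu)$, the level set $J^{-1}(\mu)$ is a coisotropic (embedded) submanifold of $M$, and $T_xJ^{-1}(\mu)^\perp=T_x(Gx)$; that is, the characteristic distribution of $J^{-1}(\mu)$ at $x$ is $T_x(Gx)$. -/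

import Mathlib

open scoped Manifold ContDiff

noncomputable section

namespace MomentumMap

section Tangent

variable {E : Type*} [NormedAddCommGroup E] [NormedSpace ℝ E]
  {H : Type*} [TopologicalSpace H] (I : ModelWithCorners ℝ E H)
  {M : Type*} [TopologicalSpace M] [ChartedSpace H M]

/-- The tangent space `T_x S` of a subset `S` of a manifold `M`, as a set of tangent vectors of `M`:
the velocities at time `0` of the smooth curves `γ : (-ε, ε) → M` which stay in `S` and satisfy
`γ 0 = x`. For embedded submanifolds, and for initial (weakly embedded) submanifolds such as the
orbits of a second countable Lie group, this is the usual tangent space.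

The last condition is an equality in the tangent bundle: it says `γ 0 = x` and `γ' 0 = v`. -/
def tangentSpaceOf (S : Set M) (x : M) : Set (TangentSpace I x) :=
  {v | ∃ (γ : ℝ → M) (ε : ℝ), 0 < ε ∧
    ContMDiffOn 𝓘(ℝ, ℝ) I ∞ γ (Set.Ioo (-ε) ε) ∧
    (∀ t ∈ Set.Ioo (-ε) ε, γ t ∈ S) ∧
    (⟨γ 0, mfderiv 𝓘(ℝ, ℝ) I γ 0 (1 : ℝ)⟩ : TangentBundle I M) = ⟨x, v⟩}

/-- Embedded submanifolds of codimension `k`: subsets which are locally the zero set of a smooth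
submersion to `ℝᵏ`. -/
def IsEmbeddedSubmanifold (k : ℕ) (N : Set M) : Prop :=
  ∀ x ∈ N, ∃ (U : Set M) (f : M → EuclideanSpace ℝ (Fin k)), IsOpen U ∧ x ∈ U ∧
    ContMDiffOn I 𝓘(ℝ, EuclideanSpace ℝ (Fin k)) ∞ f U ∧
    N ∩ U = {y ∈ U | f y = 0} ∧
    ∀ y ∈ N ∩ U, Function.Surjective (mfderiv I 𝓘(ℝ, EuclideanSpace ℝ (Fin k)) f y)

/-- A point `c` of a normed space is a regular value of `f` if the differential of `f` is
surjective at every point of the level set `f ⁻¹' {c}`. -/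
def IsRegularValue {F : Type*} [NormedAddCommGroup F] [NormedSpace ℝ F] (f : M → F) (c : F) :
    Prop :=
  ∀ x ∈ f ⁻¹' {c}, Function.Surjective (mfderiv I 𝓘(ℝ, F) f x)

end Tangent

section Symplectic

variable {E : Type*} [NormedAddCommGroup E] [NormedSpace ℝ E]
  {H : Type*} [TopologicalSpace H] {I : ModelWithCorners ℝ E H}
  {M : Type*} [TopologicalSpace M] [ChartedSpace H M]

/-- The expression of a 2-form `Ω` in the preferred chart at `x₀`: its pullback by the inverse of
the chart, a 2-form on the chart's target in the model vector space `E`. -/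
def chartForm (Ω : (x : M) → TangentSpace I x [⋀^Fin 2]→L[ℝ] ℝ) (x₀ : M) (u : E) :
    E [⋀^Fin 2]→L[ℝ] ℝ :=
  (Ω ((extChartAt I x₀).symm u)).compContinuousLinearMap
    (mfderiv 𝓘(ℝ, E) I (extChartAt I x₀).symm u)

/-- Symplectic forms: smooth, closed, nondegenerate 2-forms (on a manifold without boundary).
Smoothness and the vanishing of the exterior derivative are read in charts. -/
structure IsSymplecticForm (Ω : (x : M) → TangentSpace I x [⋀^Fin 2]→L[ℝ] ℝ) : Prop where
  smooth : ∀ x₀ : M, ContDiffOn ℝ ∞ (chartForm Ω x₀) (extChartAt I x₀).target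
  closed : ∀ x₀ : M, ∀ u ∈ (extChartAt I x₀).target, extDeriv (chartForm Ω x₀) u = 0
  nondegenerate : ∀ (x : M) (v : TangentSpace I x),
    (∀ w : TangentSpace I x, Ω x ![v, w] = 0) → v = 0

/-- The `Ω`-orthogonal of a set of tangent vectors at `x`. -/
def orthogonal (Ω : (x : M) → TangentSpace I x [⋀^Fin 2]→L[ℝ] ℝ) {x : M}
    (V : Set (TangentSpace I x)) : Set (TangentSpace I x) :=
  {v | ∀ w ∈ V, Ω x ![v, w] = 0}

/-- Coisotropic submanifolds: embedded submanifolds whose tangent spaces contain their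
`Ω`-orthogonals. -/
def IsCoisotropic (Ω : (x : M) → TangentSpace I x [⋀^Fin 2]→L[ℝ] ℝ) (N : Set M) : Prop :=
  (∃ k : ℕ, IsEmbeddedSubmanifold I k N) ∧
    ∀ x ∈ N, orthogonal Ω (tangentSpaceOf I N x) ⊆ tangentSpaceOf I N x

end Symplectic

section LieGroup

variable {EG : Type*} [NormedAddCommGroup EG] [NormedSpace ℝ EG]
  {HG : Type*} [TopologicalSpace HG] (IG : ModelWithCorners ℝ EG HG)
  {G : Type*} [TopologicalSpace G] [ChartedSpace HG G]

/-- The dual `𝔤*` of the Lie algebra `𝔤 = T_1 G`, a normed space (`T_1 G` is by definition the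
model space `EG` of `G`). -/
abbrev LieDual {EG : Type*} [NormedAddCommGroup EG] [NormedSpace ℝ EG]
    {HG : Type*} [TopologicalSpace HG] (_IG : ModelWithCorners ℝ EG HG) (_G : Type*) : Type _ :=
  EG →L[ℝ] ℝ

/-- The adjoint action `Ad_g : 𝔤 → 𝔤`, the differential at `1` of `h ↦ g h g⁻¹`. -/
def Ad [Group G] (g : G) : GroupLieAlgebra IG G →L[ℝ] GroupLieAlgebra IG G :=
  (mfderiv IG IG (fun h : G => g * h * g⁻¹) 1 : EG →L[ℝ] EG)

/-- The coadjoint action `(g, μ) ↦ Ad*_{g⁻¹} μ = μ ∘ Ad_{g⁻¹}`. -/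
def coadjoint [Group G] (g : G) (μ : LieDual IG G) : LieDual IG G :=
  μ.comp (Ad IG g⁻¹ : EG →L[ℝ] EG)

/-- The isotropy group `G_μ` of `μ` for the coadjoint action. -/
def isotropy [Group G] (μ : LieDual IG G) : Set G :=
  {g | coadjoint IG g μ = μ}

variable {E : Type*} [NormedAddCommGroup E] [NormedSpace ℝ E]
  {H : Type*} [TopologicalSpace H] (I : ModelWithCorners ℝ E H)
  {M : Type*} [TopologicalSpace M] [ChartedSpace H M]

/-- The infinitesimal generator `ξ_M` of the action corresponding to `ξ ∈ 𝔤`: its value at `x` is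
the image of `ξ` under the differential at `1` of `g ↦ g • x`. This differential takes values
in the tangent space at `1 • x = x`. -/
def infinitesimalGenerator [Group G] [MulAction G M] (ξ : GroupLieAlgebra IG G) (x : M) :
    TangentSpace I x :=
  (mfderiv IG I (fun g : G => g • x) 1 : EG →L[ℝ] E) ξ

variable {I}

/-- The action preserves `Ω`: `Φ_g^* Ω = Ω` for all `g`. -/
def IsSymplecticAction (G : Type*) [Group G] [MulAction G M]
    (Ω : (x : M) → TangentSpace I x [⋀^Fin 2]→L[ℝ] ℝ) : Prop :=
  ∀ (g : G) (x : M),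
    (Ω (g • x)).compContinuousLinearMap (mfderiv I I (fun y : M => g • y) x) = Ω x

/-- Momentum maps: smooth `J : M → 𝔤*` such that for each `ξ ∈ 𝔤` the function
`Ĵ(ξ) : x ↦ J(x) ξ` satisfies `d Ĵ(ξ) = i_{ξ_M} Ω`. -/
structure IsMomentumMap [Group G] [MulAction G M]
    (Ω : (x : M) → TangentSpace I x [⋀^Fin 2]→L[ℝ] ℝ) (J : M → LieDual IG G) : Prop where
  smooth : ContMDiff I 𝓘(ℝ, LieDual IG G) ∞ J
  mfderiv_eq : ∀ (ξ : GroupLieAlgebra IG G) (x : M) (v : TangentSpace I x),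
    mfderiv I 𝓘(ℝ, ℝ) (fun y : M => J y ξ) x v =
      Ω x ![infinitesimalGenerator IG I ξ x, v]

/-- `Ad*`-equivariance: `J(Φ_g(x)) = Ad*_{g⁻¹} J(x)`. -/
def IsAdEquivariant [Group G] [MulAction G M] (J : M → LieDual IG G) : Prop :=
  ∀ (g : G) (x : M), J (g • x) = coadjoint IG g (J x)

end LieGroup

/-- The set `{g • x | g ∈ S}`; for `S` the isotropy group `G_μ`, this is the orbit `G_μ x`. -/
def orbitOf {G M : Type*} [Group G] [MulAction G M] (S : Set G) (x : M) : Set M :=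
  (fun g : G => g • x) '' S

end MomentumMap

end

section

open Set Filter Topology

/-! ### Calculus in the model space: integral curves, level sets, countable-valued maps. -/

section Calculus

variable {E : Type*} [NormedAddCommGroup E] [NormedSpace ℝ E]
  {F : Type*} [NormedAddCommGroup F] [NormedSpace ℝ F]

/-! Write `𝔤 • x` for the space of vectors `ξ_M(x)`. The momentum identity `dJ(v) ξ = Ω(ξ_M, v)`
says that `ker dJ` at `x` is the orthogonal of `𝔤 • x`. At a regular value the level set has tangent
space `ker dJ`, so (ii) amounts to `T_x(Gx) = 𝔤 • x`, and (iii) follows by taking the orthogonal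
twice, nondegeneracy giving `W^⊥⊥ = W`.

For (i), if `ξ_M(x)` lies in `ker dJ`, then `g ↦ J(g • x)` has a differential at `1` that kills `ξ`.
By equivariance it is constant along the integral curve through `1` of the left-invariant field of
`ξ`. That curve therefore stays in `G_μ`, and pushing it to `M` gives `ξ_M(x)` as a velocity
(`exists_curve_eq_of_equivariant`).

The delicate point is `T_x(Gx) ⊆ 𝔤 • x`, because an orbit need not be embedded and a curve in it
need not come with a smooth lift to `G`. Surjectivity of `dJ` makes `ξ ↦ ξ_M(x)` injective, so `G`
times a slice is a local model of `M` at `x`. By second countability of `G` the orbit meets the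
slice in a countable set, so the slice component of a curve in the orbit is constant
(`exists_infinitesimalGenerator_eq_of_mem_tangentSpaceOf_orbit`). -/

/-- Bootstrapping: if `c` is `C^n`, then so is `c' = V ∘ c`, hence `c` is `C^(n+1)`. -/
theorem contDiffOn_infty_of_hasDerivAt {V : E → E} {U : Set E} (hV : ContDiffOn ℝ ∞ V U)
    {c : ℝ → E} {s : Set ℝ} (hs : IsOpen s) (hcU : MapsTo c s U)
    (hc : ∀ t ∈ s, HasDerivAt c (V (c t)) t) : ContDiffOn ℝ ∞ c s := by
  rw [contDiffOn_infty]
  intro n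
  induction n with
  | zero =>
    exact contDiffOn_zero.2 fun t ht => (hc t ht).continuousAt.continuousWithinAt
  | succ n ih =>
    push_cast
    rw [contDiffOn_succ_iff_deriv_of_isOpen hs]
    refine ⟨fun t ht => (hc t ht).differentiableAt.differentiableWithinAt, by simp, ?_⟩
    refine ((hV.of_le (by exact_mod_cast le_top)).comp ih hcU).congr fun t ht => ?_
    exact (hc t ht).deriv

theorem exists_contDiffOn_integralCurve [CompleteSpace E] {V : E → E} {U : Set E} (hU : IsOpen U)
    (hV : ContDiffOn ℝ ∞ V U) {e₀ : E} (he₀ : e₀ ∈ U) :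
    ∃ (c : ℝ → E) (ε : ℝ), 0 < ε ∧ ContDiffOn ℝ ∞ c (Ioo (-ε) ε) ∧ MapsTo c (Ioo (-ε) ε) U ∧
      c 0 = e₀ ∧ ∀ t ∈ Ioo (-ε) ε, HasDerivAt c (V (c t)) t := by
  obtain ⟨c, hc0, hc⟩ := ((hV.contDiffAt (hU.mem_nhds he₀)).of_le
    (by exact_mod_cast le_top : (1 : WithTop ℕ∞) ≤ ∞)
    ).exists_forall_mem_closedBall_exists_eq_forall_mem_Ioo_hasDerivAt₀ 0
  obtain ⟨δ, hδ, hc⟩ := hc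
  have hcont : ContinuousAt c 0 := (hc 0 (by simp [hδ])).continuousAt
  have hmem : ∀ᶠ t in 𝓝 (0 : ℝ), c t ∈ U :=
    hcont.eventually (by rw [hc0]; exact hU.mem_nhds he₀)
  obtain ⟨ε, hε, hmem⟩ := Metric.eventually_nhds_iff_ball.1 hmem
  rw [Real.ball_eq_Ioo] at hmem
  have hsub₁ : Ioo (-(min δ ε)) (min δ ε) ⊆ Ioo (0 - δ) (0 + δ) :=
    Ioo_subset_Ioo (by simp) (by simp)
  have hsub₂ : Ioo (-(min δ ε)) (min δ ε) ⊆ Ioo (0 - ε) (0 + ε) :=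
    Ioo_subset_Ioo (by simp) (by simp)
  have hd : ∀ t ∈ Ioo (-(min δ ε)) (min δ ε), HasDerivAt c (V (c t)) t :=
    fun t ht => hc t (hsub₁ ht)
  have hm : MapsTo c (Ioo (-(min δ ε)) (min δ ε)) U := fun t ht => hmem t (hsub₂ ht)
  exact ⟨c, min δ ε, lt_min hδ hε, contDiffOn_infty_of_hasDerivAt hV isOpen_Ioo hm hd, hm, hc0, hd⟩

theorem eq_of_hasDerivAt_zero_Ioo {f : ℝ → F} {ε : ℝ}
    (hf : ∀ t ∈ Ioo (-ε) ε, HasDerivAt f 0 t) {t : ℝ} (ht : t ∈ Ioo (-ε) ε) : f t = f 0 := by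
  have hε : 0 < ε := by have := ht.1.trans ht.2; linarith
  exact isOpen_Ioo.is_const_of_deriv_eq_zero isPreconnected_Ioo
    (fun s hs => (hf s hs).differentiableAt.differentiableWithinAt)
    (fun s hs => (hf s hs).deriv) ht ⟨by linarith, hε⟩

/-- The kernel vector `v` extends to a smooth vector field tangent to the fibres of `f`; its
integral curve through `e₀` is the required curve. -/
theorem exists_curve_levelSet [FiniteDimensional ℝ E] [FiniteDimensional ℝ F] {f : E → F}
    {U : Set E} (hU : IsOpen U) (hf : ContDiffOn ℝ ∞ f U) {e₀ : E} (he₀ : e₀ ∈ U)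
    (hsurj : Function.Surjective (fderiv ℝ f e₀)) {v : E} (hv : fderiv ℝ f e₀ v = 0) :
    ∃ (c : ℝ → E) (ε : ℝ), 0 < ε ∧ ContDiffOn ℝ ∞ c (Ioo (-ε) ε) ∧ MapsTo c (Ioo (-ε) ε) U ∧
      c 0 = e₀ ∧ HasDerivAt c v 0 ∧ ∀ t ∈ Ioo (-ε) ε, f (c t) = f e₀ := by
  have := FiniteDimensional.complete ℝ E
  have := FiniteDimensional.complete ℝ F
  obtain ⟨R₀, hR₀⟩ := (fderiv ℝ f e₀ : E →ₗ[ℝ] F).exists_rightInverse_of_surjective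
    (LinearMap.range_eq_top.2 hsurj)
  let R : F →L[ℝ] E := R₀.toContinuousLinearMap
  have hR : (fderiv ℝ f e₀).comp R = ContinuousLinearMap.id ℝ F := by
    ext y; exact LinearMap.congr_fun hR₀ y
  have hfd : ContDiffOn ℝ ∞ (fderiv ℝ f) U := hf.fderiv_of_isOpen hU (by simp)
  have hQ : ContDiffOn ℝ ∞ (fun e => (fderiv ℝ f e).comp R) U :=
    hfd.clm_comp contDiffOn_const
  let Inv : Set (F →L[ℝ] F) := range ((↑) : (F ≃L[ℝ] F) → F →L[ℝ] F)
  have hInv : IsOpen Inv := ContinuousLinearEquiv.isOpen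
  -- `Df ∘ R` is the identity at `e₀` and invertibility is an open condition.
  let U' : Set E := U ∩ (fun e => (fderiv ℝ f e).comp R) ⁻¹' Inv
  have hU' : IsOpen U' := hQ.continuousOn.isOpen_inter_preimage hU hInv
  have he₀' : e₀ ∈ U' := ⟨he₀, ContinuousLinearEquiv.refl ℝ F, by simp [hR]⟩
  -- The projection of `v` onto `ker (Df_e)` along the range of `R`; it equals `v` at `e₀`.
  let V : E → E := fun e =>
    v - R (ContinuousLinearMap.inverse ((fderiv ℝ f e).comp R) (fderiv ℝ f e v))
  have hV : ContDiffOn ℝ ∞ V U' := by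
    intro e he
    obtain ⟨heU, T, hT⟩ := he
    replace hT : (T : F →L[ℝ] F) = (fderiv ℝ f e).comp R := hT
    have h1 : ContDiffAt ℝ ∞ (fderiv ℝ f) e := hfd.contDiffAt (hU.mem_nhds heU)
    have h2 : ContDiffAt ℝ ∞ (fun e => (fderiv ℝ f e).comp R) e := hQ.contDiffAt (hU.mem_nhds heU)
    have h3 : ContDiffAt ℝ ∞
        (fun e => ContinuousLinearMap.inverse ((fderiv ℝ f e).comp R)) e := by
      refine ContDiffAt.comp (g := ContinuousLinearMap.inverse) e ?_ h2
      rw [← hT]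
      exact contDiffAt_map_inverse T
    exact (contDiffAt_const.sub (R.contDiff.contDiffAt.comp e
      (h3.clm_apply (h1.clm_apply contDiffAt_const)))).contDiffWithinAt
  have hfV : ∀ e ∈ U', fderiv ℝ f e (V e) = 0 := by
    rintro e ⟨-, T, hT⟩
    replace hT : (T : F →L[ℝ] F) = (fderiv ℝ f e).comp R := hT
    have h : ∀ y, fderiv ℝ f e (R (ContinuousLinearMap.inverse ((fderiv ℝ f e).comp R) y)) = y := by
      intro y
      have : fderiv ℝ f e (R (ContinuousLinearMap.inverse ((fderiv ℝ f e).comp R) y)) =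
        ((fderiv ℝ f e).comp R) (ContinuousLinearMap.inverse ((fderiv ℝ f e).comp R) y) := rfl
      rw [this, ← hT]
      simp
    simp only [V, map_sub, h, sub_self]
  obtain ⟨c, ε, hε, hc, hcU, hc0, hcd⟩ := exists_contDiffOn_integralCurve hU' hV he₀'
  refine ⟨c, ε, hε, hc, fun t ht => (hcU ht).1, hc0, ?_, fun t ht => ?_⟩
  · have := hcd 0 ⟨by linarith, hε⟩
    simpa [hc0, V, hv] using this
  · rw [← hc0]
    refine eq_of_hasDerivAt_zero_Ioo (f := f ∘ c) (fun s hs => ?_) ht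
    have h := (((hf.contDiffAt (hU.mem_nhds (hcU hs).1)).differentiableAt (by simp)
      ).hasFDerivAt).comp_hasDerivAt s (hcd s hs)
    rwa [hfV _ (hcU hs)] at h

/-- If two values differed, the distance to one of them would take every value in a nontrivial
interval, which is uncountable. -/
theorem IsPreconnected.apply_eq_of_mapsTo_countable {X Y : Type*} [TopologicalSpace X]
    [NormedAddCommGroup Y] {s : Set X}
    (hs : IsPreconnected s) {w : X → Y} (hw : ContinuousOn w s) {C : Set Y} (hC : C.Countable)
    (hwC : MapsTo w s C) {a b : X} (ha : a ∈ s) (hb : b ∈ s) : w a = w b := by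
  by_contra hne
  have hpos : 0 < ‖w a - w b‖ := norm_pos_iff.2 (sub_ne_zero.2 hne)
  have hcont : ContinuousOn (fun y => ‖w y - w b‖) s := (hw.sub continuousOn_const).norm
  have hsub : Icc 0 ‖w a - w b‖ ⊆ (fun z => ‖z - w b‖) '' C := by
    intro r hr
    have := hs.intermediate_value hb ha hcont
    obtain ⟨y, hy, rfl⟩ := this (by simpa using hr)
    exact ⟨w y, hwC hy, rfl⟩
  have hcount : (Icc 0 ‖w a - w b‖).Countable := (hC.image _).mono hsub
  have := Cardinal.mk_Icc_real hpos
  rw [← Cardinal.le_aleph0_iff_set_countable, this] at hcount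
  exact absurd hcount (not_le.2 Cardinal.aleph0_lt_continuum)

end Calculus

/-! ### Tangent vectors of subsets, read in a chart. -/

section Charts

variable {E : Type*} [NormedAddCommGroup E] [NormedSpace ℝ E]
  {H : Type*} [TopologicalSpace H] {I : ModelWithCorners ℝ E H} [I.Boundaryless]
  {M : Type*} [TopologicalSpace M] [ChartedSpace H M]

theorem MDifferentiableAt.hasFDerivAt_writtenInExtChartAt
    {E' : Type*} [NormedAddCommGroup E'] [NormedSpace ℝ E']
    {H' : Type*} [TopologicalSpace H'] {I' : ModelWithCorners ℝ E' H'}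
    {M' : Type*} [TopologicalSpace M'] [ChartedSpace H' M'] {f : M → M'} {x : M}
    (hf : MDifferentiableAt I I' f x) :
    HasFDerivAt (writtenInExtChartAt I I' x f) (mfderiv I I' f x : E →L[ℝ] E')
      (extChartAt I x x) := by
  have h := hf.hasMFDerivAt.2
  rw [I.range_eq_univ] at h
  exact HasFDerivWithinAt.hasFDerivAt h univ_mem

omit [I.Boundaryless] in
-- `TangentSpace I x` is the model space `E` through the preferred chart at `x`, so the velocity of
-- the chart expression of a curve through `x` is literally `v`.
theorem MomentumMap.mem_tangentSpaceOf_iff [IsManifold I ∞ M] {S : Set M} {x : M}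
    {v : TangentSpace I x} :
    v ∈ MomentumMap.tangentSpaceOf I S x ↔ ∃ (c : ℝ → E) (ε : ℝ), 0 < ε ∧
      ContDiffOn ℝ ∞ c (Ioo (-ε) ε) ∧ MapsTo c (Ioo (-ε) ε) (extChartAt I x).target ∧
      (∀ t ∈ Ioo (-ε) ε, (extChartAt I x).symm (c t) ∈ S) ∧
      c 0 = extChartAt I x x ∧ HasDerivAt c (v : E) 0 := by
  constructor
  · rintro ⟨γ, ε, hε, hγ, hS, h0⟩
    have h0mem : (0 : ℝ) ∈ Ioo (-ε) ε := ⟨by linarith, hε⟩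
    have hγ0 : γ 0 = x := congrArg Bundle.TotalSpace.proj h0
    subst hγ0
    have hv : mfderiv 𝓘(ℝ, ℝ) I γ 0 (1 : ℝ) = v := by simpa using h0
    have hγd : MDifferentiableAt 𝓘(ℝ, ℝ) I γ 0 :=
      (hγ.contMDiffAt (isOpen_Ioo.mem_nhds h0mem)).mdifferentiableAt (by simp)
    have hcont : ContinuousAt γ 0 := hγd.continuousAt
    have hsrc : ∀ᶠ t in 𝓝 (0 : ℝ), γ t ∈ (extChartAt I (γ 0)).source :=
      hcont.eventually (extChartAt_source_mem_nhds (γ 0))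
    obtain ⟨δ, hδ, hsrc⟩ := Metric.eventually_nhds_iff_ball.1 hsrc
    rw [Real.ball_eq_Ioo] at hsrc
    have hsub₁ : Ioo (-(min δ ε)) (min δ ε) ⊆ Ioo (0 - δ) (0 + δ) :=
      Ioo_subset_Ioo (by simp) (by simp)
    have hsub₂ : Ioo (-(min δ ε)) (min δ ε) ⊆ Ioo (-ε) ε :=
      Ioo_subset_Ioo (by simp) (by simp)
    refine ⟨extChartAt I (γ 0) ∘ γ, min δ ε, lt_min hδ hε, ?_, ?_, ?_, rfl, ?_⟩
    · rw [← contMDiffOn_iff_contDiffOn]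
      exact (contMDiffOn_extChartAt (I := I) (x := γ 0)).comp (hγ.mono hsub₂)
        fun t ht => by simpa using hsrc t (hsub₁ ht)
    · exact fun t ht => (extChartAt I (γ 0)).map_source (hsrc t (hsub₁ ht))
    · intro t ht
      rw [Function.comp_apply, (extChartAt I (γ 0)).left_inv (hsrc t (hsub₁ ht))]
      exact hS t (hsub₂ ht)
    · obtain ⟨L, hL⟩ : ∃ L : ℝ →L[ℝ] E, L = mfderiv 𝓘(ℝ, ℝ) I γ 0 := ⟨_, rfl⟩
      have h : HasFDerivAt (extChartAt I (γ 0) ∘ γ) L (0 : ℝ) := by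
        rw [hL]
        exact hγd.hasFDerivAt_writtenInExtChartAt
      have hLv : L 1 = v := by rw [← hv, hL]; rfl
      rw [← hLv]
      exact h.hasDerivAt
  · rintro ⟨c, ε, hε, hc, hmaps, hS, h0, hd⟩
    have h0mem : (0 : ℝ) ∈ Ioo (-ε) ε := ⟨by linarith, hε⟩
    have hγ0 : ((extChartAt I x).symm ∘ c) 0 = x := by simp [h0]
    refine ⟨(extChartAt I x).symm ∘ c, ε, hε, ?_, hS, ?_⟩
    · exact (contMDiffOn_extChartAt_symm x).comp hc.contMDiffOn hmaps
    · have key : HasMFDerivAt 𝓘(ℝ, ℝ) I ((extChartAt I x).symm ∘ c) 0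
          (ContinuousLinearMap.toSpanSingleton ℝ (v : E) : ℝ →L[ℝ] E) := by
        refine ⟨?_, ?_⟩
        · refine ContinuousAt.comp ?_ hd.continuousAt
          rw [h0]
          exact continuousAt_extChartAt_symm x
        · simp only [writtenInExtChartAt, extChartAt_model_space_eq_id, PartialEquiv.refl_symm,
            PartialEquiv.refl_coe, Function.comp_id, modelWithCornersSelf_coe, range_id, id_eq]
          rw [hγ0]
          have hev : extChartAt I x ∘ (extChartAt I x).symm ∘ c =ᶠ[𝓝 (0 : ℝ)] c := by
            filter_upwards [isOpen_Ioo.mem_nhds h0mem] with t ht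
            exact (extChartAt I x).right_inv (hmaps ht)
          exact (hd.congr_of_eventuallyEq hev).hasFDerivAt.hasFDerivWithinAt
      -- The curve starts at `x` only propositionally, so the two vectors are compared in `E`.
      have hcast : ∀ (y : M) (w : TangentSpace I y), y = x → (w : E) = v →
          (⟨y, w⟩ : TangentBundle I M) = ⟨x, v⟩ := by
        rintro y w rfl hw
        exact congrArg _ hw
      refine hcast _ _ hγ0 ?_
      rw [key.mfderiv]
      exact one_smul ℝ (v : E)

end Charts

namespace MomentumMap

variable {E : Type*} [NormedAddCommGroup E] [NormedSpace ℝ E]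
  {H : Type*} [TopologicalSpace H] {I : ModelWithCorners ℝ E H} [I.Boundaryless]
  {M : Type*} [TopologicalSpace M] [ChartedSpace H M] [IsManifold I ∞ M]
  {EG : Type*} [NormedAddCommGroup EG] [NormedSpace ℝ EG]
  {HG : Type*} [TopologicalSpace HG] {IG : ModelWithCorners ℝ EG HG} [IG.Boundaryless]
  {G : Type*} [TopologicalSpace G] [ChartedSpace HG G] [Group G]

/-! ### The action in charts near `(1, x)`, and its partial derivatives. -/

section Action

variable (I IG G) in
/-- The action `(g, y) ↦ g • y` read in the preferred charts at `1 : G` and at `x : M`. -/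
noncomputable def actionInCharts [MulAction G M] (x : M) (p : EG × E) : E :=
  extChartAt I x ((extChartAt IG (1 : G)).symm p.1 • (extChartAt I x).symm p.2)

variable (I IG G) in
/-- The set of points where `actionInCharts` represents the action. -/
def actionDomain [MulAction G M] (x : M) : Set (EG × E) :=
  ((extChartAt IG (1 : G)).target ×ˢ (extChartAt I x).target) ∩
    (fun p : EG × E => (extChartAt IG (1 : G)).symm p.1 • (extChartAt I x).symm p.2) ⁻¹'
      (extChartAt I x).source

variable [IsManifold IG ∞ G] [MulAction G M] [ContMDiffSMul IG I ∞ G M] (x : M)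

omit [I.Boundaryless] [IG.Boundaryless] in
theorem contMDiffOn_smul_extChartAt_symm :
    ContMDiffOn 𝓘(ℝ, EG × E) I ∞
      (fun p : EG × E => (extChartAt IG (1 : G)).symm p.1 • (extChartAt I x).symm p.2)
      ((extChartAt IG (1 : G)).target ×ˢ (extChartAt I x).target) := by
  have h₁ : ContMDiffOn 𝓘(ℝ, EG × E) IG ∞ (fun p : EG × E => (extChartAt IG (1 : G)).symm p.1)
      ((extChartAt IG (1 : G)).target ×ˢ (extChartAt I x).target) :=
    (contMDiffOn_extChartAt_symm (1 : G)).comp contDiff_fst.contMDiff.contMDiffOn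
      fun p hp => hp.1
  have h₂ : ContMDiffOn 𝓘(ℝ, EG × E) I ∞ (fun p : EG × E => (extChartAt I x).symm p.2)
      ((extChartAt IG (1 : G)).target ×ˢ (extChartAt I x).target) :=
    (contMDiffOn_extChartAt_symm x).comp contDiff_snd.contMDiff.contMDiffOn
      fun p hp => hp.2
  exact fun p hp => (h₁ p hp).smul (h₂ p hp)

theorem isOpen_actionDomain : IsOpen (actionDomain I IG G x) :=
  (contMDiffOn_smul_extChartAt_symm (I := I) (IG := IG) (G := G) x).continuousOn.isOpen_inter_preimage
    ((isOpen_extChartAt_target _).prod (isOpen_extChartAt_target _)) (isOpen_extChartAt_source _)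

omit [I.Boundaryless] [IG.Boundaryless] in
theorem contDiffOn_actionInCharts :
    ContDiffOn ℝ ∞ (actionInCharts I IG G x) (actionDomain I IG G x) := by
  rw [← contMDiffOn_iff_contDiffOn]
  exact (contMDiffOn_extChartAt (I := I) (x := x)).comp
    ((contMDiffOn_smul_extChartAt_symm x).mono inter_subset_left)
    fun p hp => by simpa using hp.2

omit [I.Boundaryless] [IG.Boundaryless] [IsManifold I ∞ M] [IsManifold IG ∞ G]
  [ContMDiffSMul IG I ∞ G M] in
theorem mem_actionDomain_one {u : E} (hu : u ∈ (extChartAt I x).target) :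
    (extChartAt IG (1 : G) 1, u) ∈ actionDomain I IG G x := by
  refine ⟨⟨mem_extChartAt_target _, hu⟩, ?_⟩
  simpa using (extChartAt I x).map_target hu

omit [I.Boundaryless] [IG.Boundaryless] [IsManifold I ∞ M] [IsManifold IG ∞ G]
  [ContMDiffSMul IG I ∞ G M] in
theorem actionInCharts_one {u : E} (hu : u ∈ (extChartAt I x).target) :
    actionInCharts I IG G x (extChartAt IG (1 : G) 1, u) = u := by
  rw [actionInCharts, extChartAt_to_inv, one_smul, (extChartAt I x).right_inv hu]

theorem hasFDerivAt_actionInCharts {p : EG × E} (hp : p ∈ actionDomain I IG G x) :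
    HasFDerivAt (actionInCharts I IG G x) (fderiv ℝ (actionInCharts I IG G x) p) p :=
  (((contDiffOn_actionInCharts x).contDiffAt
    ((isOpen_actionDomain x).mem_nhds hp)).differentiableAt (by simp)).hasFDerivAt

theorem fderiv_actionInCharts_inr (v : E) :
    fderiv ℝ (actionInCharts I IG G x) (extChartAt IG (1 : G) 1, extChartAt I x x) (0, v) = v := by
  have h := (hasFDerivAt_actionInCharts (IG := IG) (G := G) x
    (mem_actionDomain_one x (mem_extChartAt_target (I := I) x))).comp (extChartAt I x x)
    (hasFDerivAt_prodMk_right (𝕜 := ℝ) (extChartAt IG (1 : G) 1) (extChartAt I x x))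
  have h' : HasFDerivAt (fun u : E => u) (ContinuousLinearMap.id ℝ E) (extChartAt I x x) :=
    hasFDerivAt_id _
  have heq : actionInCharts I IG G x ∘ (fun u => (extChartAt IG (1 : G) 1, u))
      =ᶠ[𝓝 (extChartAt I x x)] fun u => u := by
    filter_upwards [extChartAt_target_mem_nhds x] with u hu
    exact actionInCharts_one x hu
  have := (h.congr_of_eventuallyEq heq.symm).unique h'
  simpa using congrArg (fun T : E →L[ℝ] E => T v) this

theorem fderiv_actionInCharts_inl (ξ : GroupLieAlgebra IG G) :
    fderiv ℝ (actionInCharts I IG G x) (extChartAt IG (1 : G) 1, extChartAt I x x)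
      ((ξ : EG), 0) = infinitesimalGenerator IG I ξ x := by
  have h := (hasFDerivAt_actionInCharts (IG := IG) (G := G) x
    (mem_actionDomain_one x (mem_extChartAt_target (I := I) x))).comp (extChartAt IG (1 : G) 1)
    (hasFDerivAt_prodMk_left (𝕜 := ℝ) (extChartAt IG (1 : G) 1) (extChartAt I x x))
  have hs : ContMDiff IG I ∞ (fun g : G => g • x) := fun g =>
    (contMDiffAt_id (I := IG) (x := g)).smul (contMDiffAt_const (c := x))
  have h' := (hs.mdifferentiableAt (x := 1) (by simp)).hasFDerivAt_writtenInExtChartAt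
  have heq : writtenInExtChartAt IG I 1 (fun g : G => g • x) =
      actionInCharts I IG G x ∘ (fun a => (a, extChartAt I x x)) := by
    ext a
    simp [writtenInExtChartAt, actionInCharts]
  rw [heq] at h'
  exact congrArg (fun T : EG →L[ℝ] E => T ξ) (h.unique h')

end Action

/-! ### Tangent vectors of orbits. -/

section Orbit

variable [MulAction G M]

/-- Pushes a curve of `S` through `1` to `M` by `g ↦ g • x`. It serves both orbits, with `S` the
whole group or the isotropy group. -/
theorem infinitesimalGenerator_mem_tangentSpaceOf [IsManifold IG ∞ G] [ContMDiffSMul IG I ∞ G M]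
    (x : M) {S : Set G} {ξ : GroupLieAlgebra IG G} {c : ℝ → EG} {ε : ℝ} (hε : 0 < ε)
    (hc : ContDiffOn ℝ ∞ c (Ioo (-ε) ε))
    (hS : ∀ t ∈ Ioo (-ε) ε, (extChartAt IG (1 : G)).symm (c t) ∈ S)
    (h0 : c 0 = extChartAt IG (1 : G) 1) (hd : HasDerivAt c (ξ : EG) 0) :
    infinitesimalGenerator IG I ξ x ∈ tangentSpaceOf I (orbitOf S x) x := by
  rw [mem_tangentSpaceOf_iff]
  have hp₀ := mem_actionDomain_one (IG := IG) (G := G) x (mem_extChartAt_target (I := I) x)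
  have hpd : HasDerivAt (fun t => (c t, extChartAt I x x)) ((ξ : EG), (0 : E)) 0 :=
    hd.prodMk (hasDerivAt_const 0 _)
  have hev : ∀ᶠ t in 𝓝 (0 : ℝ), (c t, extChartAt I x x) ∈ actionDomain I IG G x :=
    hpd.continuousAt.eventually (by
      simp only [h0]
      exact (isOpen_actionDomain x).mem_nhds hp₀)
  obtain ⟨δ, hδ, hev⟩ := Metric.eventually_nhds_iff_ball.1 hev
  rw [Real.ball_eq_Ioo] at hev
  have hsub₁ : Ioo (-(min δ ε)) (min δ ε) ⊆ Ioo (0 - δ) (0 + δ) :=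
    Ioo_subset_Ioo (by simp) (by simp)
  have hsub₂ : Ioo (-(min δ ε)) (min δ ε) ⊆ Ioo (-ε) ε :=
    Ioo_subset_Ioo (by simp) (by simp)
  refine ⟨fun t => actionInCharts I IG G x (c t, extChartAt I x x), min δ ε, lt_min hδ hε,
    ?_, ?_, ?_, ?_, ?_⟩
  · exact (contDiffOn_actionInCharts x).comp ((hc.mono hsub₂).prodMk contDiffOn_const)
      fun t ht => hev t (hsub₁ ht)
  · exact fun t ht => (extChartAt I x).map_source (hev t (hsub₁ ht)).2
  · intro t ht
    refine ⟨_, hS t (hsub₂ ht), ?_⟩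
    have := (hev t (hsub₁ ht)).2
    simp only [mem_preimage, extChartAt_to_inv] at this
    simp only [actionInCharts, extChartAt_to_inv]
    rw [(extChartAt I x).left_inv this]
  · simp only [h0]
    exact actionInCharts_one x (mem_extChartAt_target x)
  · have h := (hasFDerivAt_actionInCharts (IG := IG) (G := G) x hp₀).comp_hasDerivAt_of_eq 0 hpd
      (by simp [h0])
    rw [fderiv_actionInCharts_inl] at h
    exact h

theorem infinitesimalGenerator_mem_tangentSpaceOf_orbit [IsManifold IG ∞ G]
    [ContMDiffSMul IG I ∞ G M] (x : M) (ξ : GroupLieAlgebra IG G) :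
    infinitesimalGenerator IG I ξ x ∈ tangentSpaceOf I (MulAction.orbit G x) x := by
  have h : orbitOf (univ : Set G) x = MulAction.orbit G x := image_univ
  rw [← h]
  let ζ : EG := ξ
  have hd : HasDerivAt (fun t : ℝ => extChartAt IG (1 : G) 1 + t • ζ) ζ 0 := by
    simpa using ((hasDerivAt_id (0 : ℝ)).smul_const ζ).const_add (extChartAt IG (1 : G) 1)
  -- A straight line in the chart replaces `exp (t ξ)`, since only the velocity at `0` matters. It
  -- may leave the chart target, which is harmless as `S` is everything.
  exact infinitesimalGenerator_mem_tangentSpaceOf x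
    (c := fun t : ℝ => extChartAt IG (1 : G) 1 + t • ζ) one_pos
    (contDiff_const.add (contDiff_id.smul contDiff_const)).contDiffOn (fun _ _ => mem_univ _)
    (by simp) hd

/-- If the orbit map is transverse to a slice near `x`, in the sense that small displacements of
points of the slice by nontrivial elements near `1` leave the slice, then an orbit meets the slice
in a countable set. -/
theorem countable_setOf_smul_mem {M : Type*} [MulAction G M] [IsTopologicalGroup G] [SecondCountableTopology G] (x : M)
    {B : Set M} {N : Set G} (hN : N ∈ 𝓝 (1 : G))
    (hinj : ∀ k ∈ N, ∀ y ∈ B, k • y ∈ B → k = 1) : {g : G | g • x ∈ B}.Countable := by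
  -- The set is discrete: near `g` any other member is `h = (h g⁻¹) g` with `h g⁻¹` in `N`, forcing
  -- `h = g`. A countable subcover by singletons then exists.
  obtain ⟨t, -, htc, hcover⟩ := TopologicalSpace.countable_cover_nhdsWithin
    (f := fun g : G => {g}) (s := {g : G | g • x ∈ B}) fun g hg => by
      have hcont : ContinuousAt (fun h : G => h * g⁻¹) g := by fun_prop
      have hnear : ∀ᶠ h in 𝓝 g, h * g⁻¹ ∈ N := hcont.eventually (by simpa using hN)
      filter_upwards [mem_nhdsWithin_of_mem_nhds hnear, self_mem_nhdsWithin] with h hh hhB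
      have := hinj (h * g⁻¹) hh (g • x) hg (by simpa [mul_smul] using hhB)
      simpa [mul_inv_eq_one] using this
  exact htc.mono (by simpa using hcover)

/-- With `W` a complement of `𝔤 • x`, the map `(g, w) ↦ g • (x + w)` is a local diffeomorphism in
charts. The `W`-coordinate of a curve in the orbit is continuous with countable range, hence
constant, so its velocity lies in `𝔤 • x`. -/
theorem exists_infinitesimalGenerator_eq_of_mem_tangentSpaceOf_orbit [FiniteDimensional ℝ E]
    [FiniteDimensional ℝ EG] [LieGroup IG ∞ G] [SecondCountableTopology G]
    [ContMDiffSMul IG I ∞ G M] {x : M}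
    (hinj : ∀ ξ : GroupLieAlgebra IG G, infinitesimalGenerator IG I ξ x = 0 → ξ = 0)
    {v : TangentSpace I x} (hv : v ∈ tangentSpaceOf I (MulAction.orbit G x) x) :
    ∃ ξ : GroupLieAlgebra IG G, infinitesimalGenerator IG I ξ x = v := by
  have := FiniteDimensional.complete ℝ E
  have := FiniteDimensional.complete ℝ EG
  have : IsTopologicalGroup G := topologicalGroup_of_lieGroup IG ∞
  obtain ⟨e, ε, hε, he, hemaps, heS, he0, hed⟩ := mem_tangentSpaceOf_iff.1 hv
  set φ := extChartAt I x with hφ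
  set ψ := extChartAt IG (1 : G) with hψ
  set m := actionInCharts I IG G x with hm
  have hp₀ : (ψ 1, φ x) ∈ actionDomain I IG G x :=
    mem_actionDomain_one x (mem_extChartAt_target (I := I) x)
  let D : EG × E →L[ℝ] E := fderiv ℝ m (ψ 1, φ x)
  have hDr : ∀ w : E, D (0, w) = w := fderiv_actionInCharts_inr x
  have hDl : ∀ ξ : EG, D (ξ, 0) = infinitesimalGenerator IG I (ξ : GroupLieAlgebra IG G) x :=
    fderiv_actionInCharts_inl x
  have hmD : HasStrictFDerivAt m D (ψ 1, φ x) :=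
    ((contDiffOn_actionInCharts x).contDiffAt
      ((isOpen_actionDomain x).mem_nhds hp₀)).hasStrictFDerivAt (by simp)
  let A : EG →L[ℝ] E := D.comp (ContinuousLinearMap.inl ℝ EG E)
  obtain ⟨W, hW⟩ := Submodule.exists_isCompl (LinearMap.range (A : EG →ₗ[ℝ] E))
  let P : EG × W →L[ℝ] EG × E := (ContinuousLinearMap.id ℝ EG).prodMap W.subtypeL
  have hL : ∀ q : EG × W, D (P q) = A q.1 + q.2 := by
    rintro ⟨ξ, w⟩
    have : P (ξ, w) = (ξ, 0) + (0, (w : E)) := by simp [P]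
    rw [this, map_add, hDr]
    rfl
  have hLinj : Function.Injective (D.comp P) := by
    rw [injective_iff_map_eq_zero]
    rintro ⟨ξ, w⟩ h0
    rw [ContinuousLinearMap.comp_apply, hL] at h0
    have hAw : A ξ = -(w : E) := eq_neg_of_add_eq_zero_left h0
    have hA0 : A ξ = 0 := by
      refine Submodule.disjoint_def.1 hW.disjoint _ ⟨ξ, rfl⟩ ?_
      rw [hAw]
      exact W.neg_mem w.2
    have hξ : ξ = 0 := hinj ξ ((hDl ξ).symm.trans hA0)
    have hw : w = 0 := by
      rw [hA0] at hAw
      exact Subtype.ext (neg_eq_zero.1 hAw.symm)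
    rw [hξ, hw]
    rfl
  have hLsurj : Function.Surjective (D.comp P) := by
    intro u
    obtain ⟨_, ⟨ξ, rfl⟩, w, hw, rfl⟩ := Submodule.mem_sup.1
      (hW.sup_eq_top ▸ Submodule.mem_top : u ∈ LinearMap.range (A : EG →ₗ[ℝ] E) ⊔ W)
    exact ⟨(ξ, ⟨w, hw⟩), hL _⟩
  let T : (EG × W) ≃L[ℝ] E := ContinuousLinearEquiv.ofBijective (D.comp P)
    (LinearMap.ker_eq_bot.2 hLinj) (LinearMap.range_eq_top.2 hLsurj)
  let Ψ : EG × W → E := fun q => m (q.1, φ x + q.2)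
  have hκ : HasStrictFDerivAt (fun q : EG × W => (q.1, φ x + (q.2 : E))) P (ψ 1, 0) := by
    refine hasStrictFDerivAt_fst.prodMk ?_
    exact (W.subtypeL.hasStrictFDerivAt.comp (ψ 1, (0 : W)) hasStrictFDerivAt_snd).const_add (φ x)
  have hΨ : HasStrictFDerivAt Ψ (T : EG × W →L[ℝ] E) (ψ 1, 0) := by
    have : HasStrictFDerivAt m D (ψ 1, φ x + ((0 : W) : E)) := by simpa using hmD
    exact this.comp (ψ 1, (0 : W)) hκ
  have hΨ0 : Ψ (ψ 1, 0) = φ x := by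
    simp only [Ψ, ZeroMemClass.coe_zero, add_zero]
    exact actionInCharts_one x (mem_extChartAt_target (I := I) x)
  let Θ := hΨ.toOpenPartialHomeomorph Ψ
  have hΘ0 : (ψ 1, 0) ∈ Θ.source := hΨ.mem_toOpenPartialHomeomorph_source
  have hgood : ∀ᶠ q in 𝓝 (ψ 1, (0 : W)),
      q ∈ Θ.source ∧ (q.1, φ x + (q.2 : E)) ∈ actionDomain I IG G x := by
    refine Filter.Eventually.and (Θ.open_source.mem_nhds hΘ0) (hκ.continuousAt.eventually ?_)
    exact (isOpen_actionDomain x).mem_nhds (by simpa using hp₀)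
  rw [nhds_prod_eq, eventually_prod_iff] at hgood
  obtain ⟨pA, hpA, pB, hpB, hgood⟩ := hgood
  -- The slice through `x`, kept small enough for `Ψ` to be injective and to represent the action.
  let B : Set M := (fun w : W => φ.symm (φ x + w)) '' {w | pB w}
  have hCcount : {g : G | g • x ∈ B}.Countable := by
    refine countable_setOf_smul_mem x (N := {k | k ∈ ψ.source ∧ pA (ψ k)}) ?_ ?_
    · exact Filter.Eventually.and (extChartAt_source_mem_nhds (1 : G))
        ((continuousAt_extChartAt (I := IG) (1 : G)).eventually hpA)
    · rintro k ⟨hk, hkA⟩ _ ⟨w, hw, rfl⟩ ⟨w', hw', hkw⟩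
      obtain ⟨h1, h2⟩ := hgood hkA hw
      obtain ⟨h1', h2'⟩ := hgood hpA.self_of_nhds hw'
      have hkw' : φ.symm (φ x + w') = k • φ.symm (φ x + w) := hkw
      -- A slice point moved by `k` back into the slice has two coordinate pairs under `Ψ`;
      -- injectivity gives `k = 1`.
      have heq : Ψ (ψ k, w) = Ψ (ψ 1, w') := by
        rw [show Ψ (ψ 1, w') = φ x + w' from actionInCharts_one x h2'.1.2]
        change φ (ψ.symm (ψ k) • φ.symm (φ x + w)) = _
        rw [ψ.left_inv hk, ← hkw', φ.right_inv h2'.1.2]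
      have := congrArg Prod.fst (Θ.injOn h1 h1' heq)
      exact ψ.injOn hk (mem_extChartAt_source (1 : G)) this
  let C : Set W := {w | pB w ∧ φ.symm (φ x + w) ∈ MulAction.orbit G x}
  have hC : C.Countable := by
    have hsub : ((↑) : W → E) '' C ⊆ (fun g : G => φ (g • x) - φ x) '' {g : G | g • x ∈ B} := by
      rintro _ ⟨w, ⟨hw, g, hg⟩, rfl⟩
      have hg' : g • x = φ.symm (φ x + w) := hg
      refine ⟨g, ⟨w, hw, hg'.symm⟩, ?_⟩
      have := (hgood hpA.self_of_nhds hw).2.1.2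
      simp only [hg']
      rw [φ.right_inv this, add_sub_cancel_left]
    exact countable_of_injective_of_countable_image Subtype.val_injective.injOn
      ((hCcount.image _).mono hsub)
  have hecont : ContinuousAt e 0 := hed.continuousAt
  have htarget : e 0 ∈ Θ.target := by
    rw [he0, ← hΨ0]
    exact Θ.map_source hΘ0
  have hsymm0 : Θ.symm (e 0) = (ψ 1, 0) := by
    rw [he0, ← hΨ0]
    exact Θ.left_inv hΘ0
  have hnear : ∀ᶠ t in 𝓝 (0 : ℝ), (e t ∈ Θ.target ∧
      pA (Θ.symm (e t)).1 ∧ pB (Θ.symm (e t)).2) ∧ t ∈ Ioo (-ε) ε := by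
    have hc : ContinuousAt (fun t => Θ.symm (e t)) 0 :=
      ContinuousAt.comp (Θ.continuousAt_symm htarget) hecont
    refine ((hecont.eventually (Θ.open_target.mem_nhds htarget)).and
      ((hc.fst.eventually ?_).and (hc.snd.eventually ?_))).and
      (isOpen_Ioo.mem_nhds ⟨by linarith, hε⟩)
    · simpa only [hsymm0] using hpA
    · simpa only [hsymm0] using hpB
  obtain ⟨δ, hδ, hnear⟩ := Metric.eventually_nhds_iff_ball.1 hnear
  have hwC : MapsTo (fun t => (Θ.symm (e t)).2) (Metric.ball 0 δ) C := by
    intro t ht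
    obtain ⟨⟨h1, h2, h3⟩, h4⟩ := hnear t ht
    refine ⟨h3, ?_⟩
    have hdom := (hgood h2 h3).2
    have het : φ (ψ.symm (Θ.symm (e t)).1 • φ.symm (φ x + (Θ.symm (e t)).2)) = e t :=
      Θ.right_inv h1
    have horb : φ.symm (e t) ∈ MulAction.orbit G x := heS t h4
    rw [← het, φ.left_inv hdom.2] at horb
    -- Removing the group factor stays in the orbit, so the slice point itself lies in `Gx`.
    rwa [← MulAction.orbit_eq_iff, MulAction.orbit_smul, MulAction.orbit_eq_iff] at horb
  have hwcont : ContinuousOn (fun t => (Θ.symm (e t)).2) (Metric.ball 0 δ) := by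
    refine continuous_snd.comp_continuousOn (Θ.continuousOn_symm.comp ?_ fun t ht => (hnear t ht).1.1)
    exact he.continuousOn.mono fun t ht => (hnear t ht).2
  have hwzero : ∀ t ∈ Metric.ball (0 : ℝ) δ, (Θ.symm (e t)).2 = 0 := by
    intro t ht
    have := (convex_ball (0 : ℝ) δ).isPreconnected.apply_eq_of_mapsTo_countable hwcont hC
      hwC ht (Metric.mem_ball_self hδ)
    simpa [hsymm0] using this
  have hinv : HasStrictFDerivAt Θ.symm (T.symm : E →L[ℝ] EG × W) (e 0) := by
    rw [he0, ← hΨ0]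
    exact hΨ.to_localInverse
  have hsd : HasDerivAt (fun t => Θ.symm (e t)) (T.symm (v : E)) 0 :=
    hinv.hasFDerivAt.comp_hasDerivAt 0 hed
  have hsnd : (T.symm (v : E)).2 = 0 := by
    have h1 : HasDerivAt (fun t => (Θ.symm (e t)).2) (T.symm (v : E)).2 0 := hsd.snd
    have h2 : HasDerivAt (fun t => (Θ.symm (e t)).2) 0 0 :=
      (hasDerivAt_const 0 (0 : W)).congr_of_eventuallyEq
        (by filter_upwards [Metric.ball_mem_nhds 0 hδ] with t ht using hwzero t ht)
    exact h1.unique h2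
  refine ⟨(T.symm (v : E)).1, ?_⟩
  have hTv : D (P (T.symm (v : E))) = v := T.apply_symm_apply v
  rw [hL, hsnd] at hTv
  simp only [ZeroMemClass.coe_zero, add_zero] at hTv
  exact (hDl _).symm.trans hTv

end Orbit

/-! ### Level sets of smooth and of equivariant maps. -/

omit [I.Boundaryless] in
theorem contDiffOn_comp_extChartAt_symm {F : Type*} [NormedAddCommGroup F] [NormedSpace ℝ F]
    {f : M → F} (hf : ContMDiff I 𝓘(ℝ, F) ∞ f) (x : M) :
    ContDiffOn ℝ ∞ (f ∘ (extChartAt I x).symm) (extChartAt I x).target := by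
  rw [← contMDiffOn_iff_contDiffOn]
  exact hf.comp_contMDiffOn (contMDiffOn_extChartAt_symm x)

omit [IsManifold I ∞ M] in
theorem hasFDerivAt_comp_extChartAt_symm {F : Type*} [NormedAddCommGroup F] [NormedSpace ℝ F]
    {f : M → F} (hf : ContMDiff I 𝓘(ℝ, F) ∞ f) (x : M) :
    HasFDerivAt (f ∘ (extChartAt I x).symm) (mfderiv I 𝓘(ℝ, F) f x : E →L[ℝ] F)
      (extChartAt I x x) :=
  (hf.mdifferentiableAt (x := x) (by simp)).hasFDerivAt_writtenInExtChartAt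

/-- A smooth map on a Lie group which intertwines left translations with linear maps is constant
along the integral curve through `1` of a left-invariant vector field, as soon as the differential
at `1` kills the corresponding vector. -/
theorem exists_curve_eq_of_equivariant [FiniteDimensional ℝ EG] [LieGroup IG ∞ G]
    {F : Type*} [NormedAddCommGroup F] [NormedSpace ℝ F] {f : G → F}
    (hf : ContMDiff IG 𝓘(ℝ, F) ∞ f) (ρ : G → F →L[ℝ] F) (hρ : ∀ g h, f (g * h) = ρ g (f h))
    {ξ : GroupLieAlgebra IG G} (hξ : (mfderiv IG 𝓘(ℝ, F) f 1 : EG →L[ℝ] F) ξ = 0) :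
    ∃ (c : ℝ → EG) (ε : ℝ), 0 < ε ∧ ContDiffOn ℝ ∞ c (Ioo (-ε) ε) ∧
      (∀ t ∈ Ioo (-ε) ε, f ((extChartAt IG (1 : G)).symm (c t)) = f 1) ∧
      c 0 = extChartAt IG (1 : G) 1 ∧ HasDerivAt c (ξ : EG) 0 := by
  have := FiniteDimensional.complete ℝ EG
  set ψ := extChartAt IG (1 : G) with hψ
  let m := actionInCharts IG IG G (1 : G)
  let ζ : EG := ξ
  -- The left-invariant field of `ξ` in the chart: the derivative of `b ↦ a b` at `b = 1`, in the
  -- direction `ζ`.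
  let V : EG → EG := fun a => fderiv ℝ m (a, ψ 1) (0, ζ)
  let U : Set EG := (fun a => (a, ψ 1)) ⁻¹' actionDomain IG IG G (1 : G)
  have hpair : ContDiff ℝ ∞ fun a : EG => (a, ψ 1) := contDiff_id.prodMk contDiff_const
  have hU : IsOpen U := (isOpen_actionDomain (1 : G)).preimage hpair.continuous
  have hV : ContDiffOn ℝ ∞ V U :=
    (((contDiffOn_actionInCharts (1 : G)).fderiv_of_isOpen (isOpen_actionDomain (1 : G))
      (by simp)).comp hpair.contDiffOn fun _ ha => ha).clm_apply contDiffOn_const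
  have h1U : ψ 1 ∈ U := mem_actionDomain_one (1 : G) (mem_extChartAt_target (I := IG) (1 : G))
  have hV1 : V (ψ 1) = ζ := fderiv_actionInCharts_inr (1 : G) ζ
  have hfs : ContDiffOn ℝ ∞ (f ∘ ψ.symm) ψ.target := contDiffOn_comp_extChartAt_symm hf 1
  have hf1 := hasFDerivAt_comp_extChartAt_symm hf (1 : G)
  have hm1 : ∀ a ∈ U, m (a, ψ 1) = a := by
    intro a ha
    have ha' : a ∈ ψ.target := ha.1.1
    simp only [m, actionInCharts, ← hψ]
    rw [ψ.left_inv (mem_extChartAt_source (1 : G)), smul_eq_mul, mul_one, ψ.right_inv ha']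
  -- Differentiating `f (a b) = ρ a (f b)` in `b` at `1` gives `df_a (V a) = ρ a (df_1 ξ) = 0`.
  have hkill : ∀ a ∈ U, fderiv ℝ (f ∘ ψ.symm) a (V a) = 0 := by
    intro a ha
    have ha' : a ∈ ψ.target := ha.1.1
    have hfa : HasFDerivAt (f ∘ ψ.symm) (fderiv ℝ (f ∘ ψ.symm) a) (m (a, ψ 1)) := by
      rw [hm1 a ha]
      exact ((hfs.contDiffAt ((isOpen_extChartAt_target _).mem_nhds ha')).differentiableAt
        (by simp)).hasFDerivAt
    have h₁ := (hfa.comp (a, ψ 1) (hasFDerivAt_actionInCharts (1 : G) ha)).comp (ψ 1)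
      (hasFDerivAt_prodMk_right (𝕜 := ℝ) a (ψ 1))
    have h₂ := (ρ (ψ.symm a)).hasFDerivAt.comp (ψ 1) hf1
    have heq : ((f ∘ ψ.symm) ∘ m) ∘ (fun b => (a, b)) =ᶠ[𝓝 (ψ 1)]
        ρ (ψ.symm a) ∘ (f ∘ ψ.symm) := by
      have hcont : ContinuousAt (fun b : EG => (a, b)) (ψ 1) := by fun_prop
      filter_upwards [hcont.eventually ((isOpen_actionDomain (1 : G)).mem_nhds ha)] with b hb
      have hb' : ψ.symm a * ψ.symm b ∈ ψ.source := hb.2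
      simp only [m, actionInCharts, ← hψ, Function.comp_apply, smul_eq_mul]
      rw [ψ.left_inv hb', hρ]
    have h := (h₁.congr_of_eventuallyEq heq.symm).unique h₂
    refine (congrArg (fun T : EG →L[ℝ] F => T ζ) h).trans ?_
    exact (congrArg (ρ (ψ.symm a)) hξ).trans (map_zero _)
  obtain ⟨c, ε, hε, hc, hcU, hc0, hcd⟩ := exists_contDiffOn_integralCurve hU hV h1U
  refine ⟨c, ε, hε, hc, fun t ht => ?_, hc0, ?_⟩
  · have h := eq_of_hasDerivAt_zero_Ioo (f := (f ∘ ψ.symm) ∘ c) (fun s hs => ?_) ht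
    · simpa [hc0, hψ] using h
    · have hs' : c s ∈ ψ.target := (hcU hs).1.1
      have h := ((hfs.contDiffAt ((isOpen_extChartAt_target _).mem_nhds hs')).differentiableAt
        (by simp)).hasFDerivAt.comp_hasDerivAt s (hcd s hs)
      rwa [hkill _ (hcU hs)] at h
  · have h := hcd 0 ⟨by linarith, hε⟩
    rwa [hc0, hV1] at h

theorem mem_tangentSpaceOf_levelSet_iff [FiniteDimensional ℝ E] {F : Type*} [NormedAddCommGroup F]
    [NormedSpace ℝ F] [FiniteDimensional ℝ F] {f : M → F} (hf : ContMDiff I 𝓘(ℝ, F) ∞ f) {x : M}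
    (hsurj : Function.Surjective (mfderiv I 𝓘(ℝ, F) f x)) {v : TangentSpace I x} :
    v ∈ tangentSpaceOf I (f ⁻¹' {f x}) x ↔ (mfderiv I 𝓘(ℝ, F) f x : E →L[ℝ] F) v = 0 := by
  obtain ⟨L, hL⟩ : ∃ L : E →L[ℝ] F, L = mfderiv I 𝓘(ℝ, F) f x := ⟨_, rfl⟩
  have hfx : HasFDerivAt (f ∘ (extChartAt I x).symm) L (extChartAt I x x) := by
    rw [hL]
    exact hasFDerivAt_comp_extChartAt_symm hf x
  have hLsurj : Function.Surjective L := by rw [hL]; exact hsurj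
  suffices v ∈ tangentSpaceOf I (f ⁻¹' {f x}) x ↔ L v = 0 by rw [this, hL]; rfl
  rw [mem_tangentSpaceOf_iff]
  constructor
  · rintro ⟨c, ε, hε, hc, hmaps, hS, h0, hd⟩
    rw [← h0] at hfx
    have h1 := hfx.comp_hasDerivAt 0 hd
    have h2 : HasDerivAt ((f ∘ (extChartAt I x).symm) ∘ c) 0 0 :=
      (hasDerivAt_const 0 (f x)).congr_of_eventuallyEq (by
        filter_upwards [isOpen_Ioo.mem_nhds (show (0 : ℝ) ∈ Ioo (-ε) ε from ⟨by linarith, hε⟩)]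
          with t ht using hS t ht)
    exact h1.unique h2
  · intro hv
    obtain ⟨c, ε, hε, hc, hmaps, h0, hd, hfc⟩ := exists_curve_levelSet
      (isOpen_extChartAt_target x) (contDiffOn_comp_extChartAt_symm hf x)
      (mem_extChartAt_target x) (by rw [hfx.fderiv]; exact hLsurj)
      (v := (v : E)) (by rw [hfx.fderiv]; exact hv)
    refine ⟨c, ε, hε, hc, hmaps, fun t ht => ?_, h0, hd⟩
    simpa using hfc t ht

omit [I.Boundaryless] [IsManifold I ∞ M] in
theorem isEmbeddedSubmanifold_levelSet {F : Type*} [NormedAddCommGroup F]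
    [NormedSpace ℝ F] [FiniteDimensional ℝ F] {f : M → F} (hf : ContMDiff I 𝓘(ℝ, F) ∞ f) {b : F}
    (hb : IsRegularValue I f b) :
    IsEmbeddedSubmanifold I (Module.finrank ℝ F) (f ⁻¹' {b}) := by
  intro x _
  let T : F ≃L[ℝ] EuclideanSpace ℝ (Fin (Module.finrank ℝ F)) :=
    ContinuousLinearEquiv.ofFinrankEq (by simp)
  have hT : ContDiff ℝ ∞ fun z : F => T (z - b) := T.contDiff.comp (contDiff_id.sub contDiff_const)
  refine ⟨univ, fun y => T (f y - b), isOpen_univ, mem_univ x,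
    (hT.contMDiff.comp hf).contMDiffOn, ?_, ?_⟩
  · ext y
    simp [sub_eq_zero]
  · rintro y ⟨hy, -⟩
    have hTd : HasFDerivAt (fun z : F => T (z - b)) (T : F →L[ℝ] _) (f y) :=
      T.hasFDerivAt.comp (f y) ((hasFDerivAt_id (f y)).sub_const b)
    have hd := HasMFDerivAt.comp y hTd.hasMFDerivAt
      (hf.mdifferentiableAt (x := y) (by simp)).hasMFDerivAt
    have hd' : mfderiv I 𝓘(ℝ, EuclideanSpace ℝ (Fin (Module.finrank ℝ F)))
      (fun y => T (f y - b)) y = _ := hd.mfderiv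
    rw [hd']
    exact T.surjective.comp (hb y hy)

end MomentumMap

/-! ### Linear algebra of nondegenerate 2-forms. -/

section Alternating

variable {V : Type*} [NormedAddCommGroup V] [NormedSpace ℝ V]

theorem ContinuousAlternatingMap.apply_pair_swap (T : V [⋀^Fin 2]→L[ℝ] ℝ) (v w : V) :
    T ![v, w] = -T ![w, v] := by
  have h := T.toAlternatingMap.map_swap ![w, v] (i := 0) (j := 1) (by simp)
  have hs : (![w, v] : Fin 2 → V) ∘ Equiv.swap 0 1 = ![v, w] := by
    ext i; fin_cases i <;> simp
  rw [hs] at h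
  exact h

/-- The bilinear form of an alternating 2-form. -/
def ContinuousAlternatingMap.toBilinForm (T : V [⋀^Fin 2]→L[ℝ] ℝ) : LinearMap.BilinForm ℝ V :=
  LinearMap.mk₂ ℝ (fun v w => T ![v, w]) (fun v v' w => T.vecCons_add ![w] v v')
    (fun c v w => T.vecCons_smul ![w] c v)
    (fun v w w' => by
      rw [T.apply_pair_swap v, T.apply_pair_swap v w, T.apply_pair_swap v w', ← neg_add]
      exact congrArg Neg.neg (T.vecCons_add ![v] w w'))
    (fun c v w => by
      rw [T.apply_pair_swap v, T.apply_pair_swap v w, smul_neg]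
      exact congrArg Neg.neg (T.vecCons_smul ![v] c w))

theorem ContinuousAlternatingMap.toBilinForm_apply (T : V [⋀^Fin 2]→L[ℝ] ℝ) (v w : V) :
    T.toBilinForm v w = T ![v, w] := rfl

theorem ContinuousAlternatingMap.toBilinForm_isRefl (T : V [⋀^Fin 2]→L[ℝ] ℝ) :
    T.toBilinForm.IsRefl := fun v w h => by
  rw [toBilinForm_apply] at h ⊢
  rw [T.apply_pair_swap, h, neg_zero]

/-- The hypothesis `hv` places `v` in `W^⊥⊥`, which is `W` by nondegeneracy in finite dimension. -/
theorem ContinuousAlternatingMap.mem_of_forall_apply_eq_zero [FiniteDimensional ℝ V]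
    (T : V [⋀^Fin 2]→L[ℝ] ℝ) (hT : ∀ v, (∀ w, T ![v, w] = 0) → v = 0) {W : Submodule ℝ V} {v : V}
    (hv : ∀ u, (∀ w ∈ W, T ![w, u] = 0) → T ![v, u] = 0) : v ∈ W := by
  have hnd : T.toBilinForm.Nondegenerate :=
    T.toBilinForm_isRefl.nondegenerate_iff_separatingLeft.2 hT
  rw [← LinearMap.BilinForm.orthogonal_orthogonal hnd T.toBilinForm_isRefl W,
    LinearMap.BilinForm.mem_orthogonal_iff]
  intro u hu
  exact T.toBilinForm_isRefl _ _ (hv u fun w hw => LinearMap.BilinForm.mem_orthogonal_iff.1 hu w hw)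

end Alternating

/-! ### Consequences of the momentum identity and of equivariance. -/

namespace MomentumMap

variable {E : Type*} [NormedAddCommGroup E] [NormedSpace ℝ E]
  {H : Type*} [TopologicalSpace H] {I : ModelWithCorners ℝ E H}
  {M : Type*} [TopologicalSpace M] [ChartedSpace H M]
  {EG : Type*} [NormedAddCommGroup EG] [NormedSpace ℝ EG]
  {HG : Type*} [TopologicalSpace HG] {IG : ModelWithCorners ℝ EG HG}
  {G : Type*} [TopologicalSpace G] [ChartedSpace HG G] [Group G]

theorem tangentSpaceOf_mono {S S' : Set M} (h : S ⊆ S') (x : M) :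
    tangentSpaceOf I S x ⊆ tangentSpaceOf I S' x := by
  rintro v ⟨γ, ε, hε, hγ, hS, h0⟩
  exact ⟨γ, ε, hε, hγ, fun t ht => h (hS t ht), h0⟩

theorem mfderiv_smul_one_comp [MulAction G M] [ContMDiffSMul IG I ∞ G M]
    {F : Type*} [NormedAddCommGroup F] [NormedSpace ℝ F] {f : M → F}
    (hf : ContMDiff I 𝓘(ℝ, F) ∞ f) (x : M) (ξ : GroupLieAlgebra IG G) :
    (mfderiv IG 𝓘(ℝ, F) (fun g : G => f (g • x)) 1 : EG →L[ℝ] F) ξ =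
      (mfderiv I 𝓘(ℝ, F) f x : E →L[ℝ] F) (infinitesimalGenerator IG I ξ x) := by
  have hs : ContMDiff IG I ∞ (fun g : G => g • x) := fun g =>
    (contMDiffAt_id (I := IG) (x := g)).smul (contMDiffAt_const (c := x))
  -- The chain rule produces the differential of `f` at `1 • x`, which is only propositionally `x`.
  have hbase : ∀ y : M, y = x →
      (mfderiv I 𝓘(ℝ, F) f y : E →L[ℝ] F) = mfderiv I 𝓘(ℝ, F) f x := by
    rintro _ rfl; rfl
  have h := mfderiv_comp (1 : G) (hf.mdifferentiableAt (x := (1 : G) • x) (by simp))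
    (hs.mdifferentiableAt (x := 1) (by simp))
  refine (congrArg (fun T : EG →L[ℝ] F => T ξ) h).trans ?_
  exact congrArg (fun T : E →L[ℝ] F => T (infinitesimalGenerator IG I ξ x))
    (hbase _ (one_smul G x))

section

variable [MulAction G M] {Ω : (x : M) → TangentSpace I x [⋀^Fin 2]→L[ℝ] ℝ} {J : M → LieDual IG G}

theorem IsMomentumMap.mfderiv_apply_apply (hJ : IsMomentumMap IG Ω J) {x : M}
    {L : E →L[ℝ] EG →L[ℝ] ℝ} (hL : L = mfderiv I 𝓘(ℝ, LieDual IG G) J x)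
    (v : TangentSpace I x) (ξ : GroupLieAlgebra IG G) :
    L v ξ = Ω x ![infinitesimalGenerator IG I ξ x, v] := by
  rw [← hJ.mfderiv_eq ξ x v, hL]
  let ev : LieDual IG G →L[ℝ] ℝ := ContinuousLinearMap.apply ℝ ℝ (ξ : EG)
  have h := HasMFDerivAt.comp x (ev.hasFDerivAt (x := J x)).hasMFDerivAt
    (hJ.smooth.mdifferentiableAt (x := x) (by simp)).hasMFDerivAt
  exact (congrArg (fun T : E →L[ℝ] ℝ => T v) h.mfderiv).symm

/-- The linear core of (ii): a functional on `𝔤` vanishes when all its values do, and the values of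
`dJ(v)` are pairings of `v` with generators. -/
theorem IsMomentumMap.mfderiv_eq_zero_iff (hJ : IsMomentumMap IG Ω J) (x : M)
    (v : TangentSpace I x) :
    (mfderiv I 𝓘(ℝ, LieDual IG G) J x : E →L[ℝ] LieDual IG G) v = 0 ↔
      ∀ ξ : GroupLieAlgebra IG G, Ω x ![infinitesimalGenerator IG I ξ x, v] = 0 := by
  obtain ⟨L, hL⟩ : ∃ L : E →L[ℝ] EG →L[ℝ] ℝ, L = mfderiv I 𝓘(ℝ, LieDual IG G) J x := ⟨_, rfl⟩
  simp only [← hJ.mfderiv_apply_apply hL]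
  rw [← hL]
  exact ContinuousLinearMap.ext_iff

/-- If `ξ_M(x) = 0`, every `dJ(v)` kills `ξ`; as `dJ` is onto `𝔤*`, every functional kills `ξ`. -/
theorem IsMomentumMap.infinitesimalGenerator_injective (hJ : IsMomentumMap IG Ω J) {x : M}
    (hx : Function.Surjective (mfderiv I 𝓘(ℝ, LieDual IG G) J x)) (ξ : GroupLieAlgebra IG G)
    (hξ : infinitesimalGenerator IG I ξ x = 0) : ξ = 0 := by
  have hdual : ∀ l : EG →L[ℝ] ℝ, l ξ = 0 := by
    intro l
    obtain ⟨v, hv⟩ := hx l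
    have h := hJ.mfderiv_apply_apply rfl v ξ
    rw [hξ] at h
    have h0 : Ω x ![0, v] = 0 := (Ω x).map_coord_zero 0 rfl
    rw [h0] at h
    rw [← h]
    exact congrArg (fun l : EG →L[ℝ] ℝ => l ξ) hv.symm
  exact SeparatingDual.eq_zero_of_forall_dual_eq_zero (R := ℝ) (V := EG) hdual

variable [FiniteDimensional ℝ E] [I.Boundaryless] [IsManifold I ∞ M]
  [FiniteDimensional ℝ EG] [IG.Boundaryless] [LieGroup IG ∞ G] [ContMDiffSMul IG I ∞ G M]

theorem IsMomentumMap.tangentSpaceOf_orbit [SecondCountableTopology G]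
    (hJ : IsMomentumMap IG Ω J) {x : M}
    (hx : Function.Surjective (mfderiv I 𝓘(ℝ, LieDual IG G) J x)) :
    tangentSpaceOf I (MulAction.orbit G x) x =
      range fun ξ : GroupLieAlgebra IG G => infinitesimalGenerator IG I ξ x := by
  refine Subset.antisymm (fun v hv => ?_) ?_
  · exact exists_infinitesimalGenerator_eq_of_mem_tangentSpaceOf_orbit
      (hJ.infinitesimalGenerator_injective hx) hv
  · rintro _ ⟨ξ, rfl⟩
    exact infinitesimalGenerator_mem_tangentSpaceOf_orbit x ξ

theorem IsMomentumMap.tangentSpaceOf_levelSet [SecondCountableTopology G]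
    (hJ : IsMomentumMap IG Ω J) {x : M}
    (hx : Function.Surjective (mfderiv I 𝓘(ℝ, LieDual IG G) J x)) :
    tangentSpaceOf I (J ⁻¹' {J x}) x =
      orthogonal Ω (tangentSpaceOf I (MulAction.orbit G x) x) := by
  ext v
  rw [mem_tangentSpaceOf_levelSet_iff hJ.smooth hx, hJ.mfderiv_eq_zero_iff,
    hJ.tangentSpaceOf_orbit hx]
  have hswap : ∀ w : TangentSpace I x, Ω x ![v, w] = -Ω x ![w, v] := fun w =>
    ContinuousAlternatingMap.apply_pair_swap (V := E) (Ω x) v w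
  simp [orthogonal, hswap]

theorem IsMomentumMap.orthogonal_tangentSpaceOf_levelSet [SecondCountableTopology G]
    (hJ : IsMomentumMap IG Ω J) (hΩ : IsSymplecticForm Ω) {x : M}
    (hx : Function.Surjective (mfderiv I 𝓘(ℝ, LieDual IG G) J x)) :
    orthogonal Ω (tangentSpaceOf I (J ⁻¹' {J x}) x) =
      tangentSpaceOf I (MulAction.orbit G x) x := by
  have hswap : ∀ v w : TangentSpace I x, Ω x ![v, w] = -Ω x ![w, v] :=
    ContinuousAlternatingMap.apply_pair_swap (V := E) (Ω x)
  refine Subset.antisymm (fun v hv => ?_) fun v hv w hw => ?_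
  · rw [hJ.tangentSpaceOf_orbit hx]
    let A : EG →L[ℝ] E := mfderiv IG I (fun g : G => g • x) 1
    suffices h : (v : E) ∈ LinearMap.range (A : EG →ₗ[ℝ] E) from h
    refine ContinuousAlternatingMap.mem_of_forall_apply_eq_zero (V := E) (Ω x)
      (hΩ.nondegenerate x) (W := LinearMap.range (A : EG →ₗ[ℝ] E)) (v := v) fun u hu => hv u ?_
    exact (mem_tangentSpaceOf_levelSet_iff hJ.smooth hx).2
      ((hJ.mfderiv_eq_zero_iff x u).2 fun ξ => hu _ ⟨ξ, rfl⟩)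
  · rw [hJ.tangentSpaceOf_levelSet hx] at hw
    rw [hswap, hw v hv, neg_zero]

omit [TopologicalSpace M] [FiniteDimensional ℝ EG] [IG.Boundaryless] [LieGroup IG ∞ G] in
theorem orbitOf_isotropy_subset (hJeq : IsAdEquivariant IG J) (x : M) :
    orbitOf (isotropy IG (J x)) x ⊆ J ⁻¹' {J x} := by
  rintro _ ⟨g, hg, rfl⟩
  exact (hJeq g x).trans hg

omit [FiniteDimensional ℝ E] in
-- The hard inclusion of (i). The coadjoint action is linear on `𝔤*`, so `g ↦ J(g • x)` satisfies `f
-- (g h) = ρ g (f h)` and a curve with velocity `ξ` keeps it equal to `J x`, that is, stays in the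
-- isotropy group.
theorem infinitesimalGenerator_mem_tangentSpaceOf_orbitOf_isotropy
    (hJs : ContMDiff I 𝓘(ℝ, LieDual IG G) ∞ J) (hJeq : IsAdEquivariant IG J) {x : M}
    {ξ : GroupLieAlgebra IG G}
    (hξ : (mfderiv I 𝓘(ℝ, LieDual IG G) J x : E →L[ℝ] LieDual IG G)
      (infinitesimalGenerator IG I ξ x) = 0) :
    infinitesimalGenerator IG I ξ x ∈ tangentSpaceOf I (orbitOf (isotropy IG (J x)) x) x := by
  have hs : ContMDiff IG I ∞ (fun g : G => g • x) := fun g =>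
    (contMDiffAt_id (I := IG) (x := g)).smul (contMDiffAt_const (c := x))
  obtain ⟨c, ε, hε, hc, hfc, h0, hd⟩ := exists_curve_eq_of_equivariant
    (f := fun g : G => J (g • x)) (hJs.comp hs)
    (fun g => ContinuousLinearMap.precomp ℝ (Ad IG g⁻¹ : EG →L[ℝ] EG))
    (fun g h => by rw [mul_smul]; exact hJeq g (h • x))
    (ξ := ξ) ((mfderiv_smul_one_comp hJs x ξ).trans hξ)
  refine infinitesimalGenerator_mem_tangentSpaceOf x hε hc (fun t ht => ?_) h0 hd
  have h := hfc t ht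
  rw [one_smul, hJeq] at h
  exact h

end

end MomentumMap

end

/-! ### The theorem. -/

theorem mainTheorem3
    {E : Type*} [NormedAddCommGroup E] [NormedSpace ℝ E] [FiniteDimensional ℝ E]
    {H : Type*} [TopologicalSpace H] (I : ModelWithCorners ℝ E H) [I.Boundaryless]
    {M : Type*} [TopologicalSpace M] [ChartedSpace H M] [IsManifold I ∞ M]
    [T2Space M] [SecondCountableTopology M]
    {EG : Type*} [NormedAddCommGroup EG] [NormedSpace ℝ EG] [FiniteDimensional ℝ EG]
    {HG : Type*} [TopologicalSpace HG] (IG : ModelWithCorners ℝ EG HG) [IG.Boundaryless]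
    {G : Type*} [TopologicalSpace G] [ChartedSpace HG G] [Group G] [LieGroup IG ∞ G]
    [T2Space G] [SecondCountableTopology G]
    [MulAction G M] [ContMDiffSMul IG I ∞ G M]
    (Ω : (x : M) → TangentSpace I x [⋀^Fin 2]→L[ℝ] ℝ)
    (hΩ : MomentumMap.IsSymplecticForm Ω)
    (hΦ : MomentumMap.IsSymplecticAction G Ω)
    (J : M → MomentumMap.LieDual IG G)
    (hJ : MomentumMap.IsMomentumMap IG Ω J)
    (hJeq : MomentumMap.IsAdEquivariant IG J)
    (μ : MomentumMap.LieDual IG G)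
    (hμ : MomentumMap.IsRegularValue I J μ)
    (x : M) (hx : x ∈ J ⁻¹' {μ}) :
    (MomentumMap.tangentSpaceOf I (MomentumMap.orbitOf (MomentumMap.isotropy IG μ) x) x =
      MomentumMap.tangentSpaceOf I (MulAction.orbit G x) x ∩
        MomentumMap.tangentSpaceOf I (J ⁻¹' {μ}) x) ∧
    (MomentumMap.tangentSpaceOf I (J ⁻¹' {μ}) x =
      MomentumMap.orthogonal Ω (MomentumMap.tangentSpaceOf I (MulAction.orbit G x) x)) ∧
    (MomentumMap.isotropy IG μ = Set.univ →
      MomentumMap.tangentSpaceOf I (MulAction.orbit G x) x ⊆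
        MomentumMap.tangentSpaceOf I (J ⁻¹' {μ}) x ∧
      MomentumMap.IsCoisotropic Ω (J ⁻¹' {μ}) ∧
      MomentumMap.orthogonal Ω (MomentumMap.tangentSpaceOf I (J ⁻¹' {μ}) x) =
        MomentumMap.tangentSpaceOf I (MulAction.orbit G x) x) := by

  obtain rfl : J x = μ := hx
  have hsurj := hμ x rfl
  refine ⟨Set.Subset.antisymm (Set.subset_inter ?_ ?_) ?_, hJ.tangentSpaceOf_levelSet hsurj,
    fun hiso => ?_⟩
  · exact MomentumMap.tangentSpaceOf_mono (Set.image_subset_range _ _) x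
  · exact MomentumMap.tangentSpaceOf_mono (MomentumMap.orbitOf_isotropy_subset hJeq x) x
  · rintro v ⟨hv, hvJ⟩
    rw [hJ.tangentSpaceOf_orbit hsurj] at hv
    obtain ⟨ξ, rfl⟩ := hv
    rw [MomentumMap.mem_tangentSpaceOf_levelSet_iff hJ.smooth hsurj] at hvJ
    exact MomentumMap.infinitesimalGenerator_mem_tangentSpaceOf_orbitOf_isotropy hJ.smooth hJeq hvJ
  -- Needed at every `y` of the level set: the orthogonal of the tangent space at `y` is `T_y(Gy)`,
  -- so this inclusion is coisotropy.
  · have horb : ∀ y, J y = J x → MomentumMap.tangentSpaceOf I (MulAction.orbit G y) y ⊆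
        MomentumMap.tangentSpaceOf I (J ⁻¹' {J x}) y := by
      intro y hy
      refine MomentumMap.tangentSpaceOf_mono ?_ y
      have hsub := MomentumMap.orbitOf_isotropy_subset hJeq y
      rw [hy, hiso] at hsub
      exact Set.image_univ.symm.subset.trans hsub
    refine ⟨horb x rfl, ⟨⟨_, MomentumMap.isEmbeddedSubmanifold_levelSet hJ.smooth hμ⟩, ?_⟩,
      hJ.orthogonal_tangentSpaceOf_levelSet hΩ hsurj⟩
    intro y hy
    have horth := hJ.orthogonal_tangentSpaceOf_levelSet hΩ (hμ y hy)
    have hyx : J y = J x := hy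
    rw [hyx] at horth
    rw [horth]
    exact horb y hy
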